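/- There is no good encoding from the full $\pi$-calculus (with mixed guarded choice) into the untyped calculus $\mathrm{CMV}^{+}$ of mixed sessions of Casal, Mordido and Vasconcelos. Both calculi use the same countably infinite set of names, and $\Rightarrow$ is the reflexive and transitive closure of the reduction relation $\to$. Sums are finite and unordered. *The $\pi$-calculus.* $P ::= \sum_{i\in I}\alpha_i.P_i \mid (\nu x)P \mid P\,|\,P \mid\, !P$ with $\alpha ::= y(x) \mid \bar y\langle z\rangle \mid \tau$, and $0$ is the empty sum. The steps are generated by $(\bar y\langle z\rangle.P+R)\,|\,(y(x).Q+N)\to P\,|\,Q\{z/x\}$ and $\tau.P+R\to P$. *Mixed sessions.* $P ::= q\,y\sum_{i\in I}M_i \mid P\,|\,P \mid (\nu yz)P \mid \mathsf{if}\ v\ \mathsf{then}\ P\ \mathsf{else}\ P \mid 0$, with branches $M ::= l!v.P \mid l?x.P$, qualifiers $q ::= \mathsf{lin}\mid\mathsf{un}$ and values $v ::= x \mid () \mid \mathsf{true} \mid \mathsf{false}$; in $(\nu yz)P$ the endpoints $y,z$ are distinct. The steps are generated by $\mathsf{if}\ \mathsf{true}\ \mathsf{then}\ P\ \mathsf{else}\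 Q\to P$, $\mathsf{if}\ \mathsf{false}\ \mathsf{then}\ P\ \mathsf{else}\ Q\to Q$ and $(\nu yz)\big(q_1\,y\,(l!v.P+M)\,|\,q_2\,z\,(l?x.Q+N)\,|\,R\big)\to(\nu yz)(P\,|\,Q\{v/x\}\,|\,R)$, where each of the two choices that is qualified $\mathsf{un}$ is kept in parallel. In both calculi steps are closed under parallel composition, restriction and structural congruence $\equiv$, the least congruence that contains $\alpha$-conversion and satisfies the usual laws: $|$ is commutative and associative with unit $0$, restrictions on $0$ can be dropped, restrictions commute, scope extrusion, $(\nu yz)P\equiv(\nu zy)P$ for mixed sessions, and $!P\equiv P\,|\,!P$ for the $\pi$-calculus. *Barbs.* A $\pi$-process has an input (output) barb on $y$ if it has an unguarded input (output) on the free name $y$. A mixed-session process has a barb on $y$ if it has an unguarded choice on the free name $y$. A process reaches a barb if one of its derivatives under $\Rightarrow$ has it; for mixed sessions write $T\Downarrow_y$. Fix a non-empty set of polarities among input and output (for example both); for a $\pi$-process $S$ write $S\Downarrow_y$ if $S$ reaches a barb on $y$ of one of these polarities. *Distributability.* A process $P$ is distributable into $P_1,\dots,P_n$ ($n\ge 1$)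 if $P\equiv(\nu\tilde y)(P_1\,|\cdots|\,P_n)$ for some sequence $\tilde y$ of restricted names (restricted pairs of endpoints for mixed sessions). *Good encodings.* A function $[\![\cdot]\!]$ from $\pi$-processes to mixed-session processes is a good encoding if there is an equivalence relation $\asymp$ on mixed-session processes that is a weak reduction barbed bisimulation (that is, $P\asymp Q$ implies that each $P\Rightarrow P'$ is matched by some $Q\Rightarrow Q'$ with $P'\asymp Q'$ and vice versa, and that $P$ and $Q$ reach the same barbs) such that the encoding is - compositional: for each $k$-ary operator $\mathrm{op}$ of the $\pi$-calculus and each finite set $N$ of names there is a $k$-ary context $C$ with $[\![\mathrm{op}(S_1,\dots,S_k)]\!]=C([\![S_1]\!],\dots,[\![S_k]\!])$, up to $\alpha$-conversion, whenever $\mathrm{fn}(S_1)\cup\dots\cup\mathrm{fn}(S_k)=N$; - name invariant: $[\![S\sigma]\!]\asymp[\![S]\!]\sigma$ for all $S$ and all finite substitutions $\sigma$ of names for names; - operationally complete: if $S\Rightarrow S'$ then $[\![S]\!]\Rightarrow T$ for some $T\asymp[\![S']\!]$; - operationally sound: if $[\![S]\!]\Rightarrow T$ then there are $S'$ and $T'$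 with $S\Rightarrow S'$, $T\Rightarrow T'$ and $T'\asymp[\![S']\!]$; - divergence reflecting: if $[\![S]\!]$ has an infinite sequence of steps, then so has $S$; - barb-sensitive: $S\Downarrow_y$ if and only if $[\![S]\!]\Downarrow_y$, for all $S$ and all names $y$; - distributability preserving: if $S$ is distributable into $S_1,\dots,S_n$, then $[\![S]\!]$ is distributable into some $T_1,\dots,T_n$ with $T_i\asymp[\![S_i]\!]$ for all $i$. -/

import Mathlib

namespace MixedSessions

/-! ## Names and generic notions on reduction systems -/

/-- The countably infinite set of names, shared by both calculi. -/
abbrev Name := ℕ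

/-- The labels of branches. -/
abbrev Label := ℕ

/-- A name outside a finite set of names. -/
def fresh (s : Finset Name) : Name := s.sup id + 1

theorem lt_fresh_of_mem {s : Finset Name} {x : Name} (hx : x ∈ s) : x < fresh s :=
  Nat.lt_succ_of_le (Finset.le_sup (f := id) hx)

section Reduction

variable {Proc Barb : Type}

/-- `P` has an infinite sequence of steps. -/
def Diverges (step : Proc → Proc → Prop) (P : Proc) : Prop :=
  ∃ f : ℕ → Proc, f 0 = P ∧ ∀ n, step (f n) (f (n + 1))

/-- `P` reaches the barb `b`. -/
def WeakBarb (step : Proc → Proc → Prop) (barb : Proc → Barb → Prop) (P : Proc) (b : Barb) :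
    Prop :=
  ∃ P', Relation.ReflTransGen step P P' ∧ barb P' b

/-- (Weak reduction, barbed) bisimulations. -/
structure IsBisimulation (step : Proc → Proc → Prop) (barb : Proc → Barb → Prop)
    (R : Proc → Proc → Prop) : Prop where
  forth : ∀ P Q, R P Q → ∀ P', Relation.ReflTransGen step P P' →
    ∃ Q', Relation.ReflTransGen step Q Q' ∧ R P' Q'
  back : ∀ P Q, R P Q → ∀ Q', Relation.ReflTransGen step Q Q' →
    ∃ P', Relation.ReflTransGen step P P' ∧ R P' Q'
  barbs : ∀ P Q, R P Q → ∀ b, WeakBarb step barb P b ↔ WeakBarb step barb Q b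

end Reduction

/-! ## The full π-calculus (mixed guarded choice, replication, no matching) -/

namespace PiCalc

/-- Action prefixes: `inp y x` is the input `y(x)`, which binds `x` in the continuation, and
`out y z` is the output of `z` on `y`. -/
inductive Prefix where
  | inp (y x : Name)
  | out (y z : Name)
  | tau

/-- Processes. `sum n α P` is the choice `∑ i, α i . P i`. -/
inductive Proc where
  | sum (n : ℕ) (α : Fin n → Prefix) (P : Fin n → Proc)
  | res (x : Name) (P : Proc)
  | par (P Q : Proc)
  | repl (P : Proc)

namespace Proc

/-- The inactive process is the empty sum. -/
def inact : Proc := sum 0 Fin.elim0 Fin.elim0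

/-- Free names. -/
def fn : Proc → Finset Name
  | sum _ α P => Finset.univ.biUnion fun i =>
      match α i with
      | .inp y x => insert y ((P i).fn \ {x})
      | .out y z => insert y (insert z (P i).fn)
      | .tau => (P i).fn
  | res x P => P.fn \ {x}
  | par P Q => P.fn ∪ Q.fn
  | repl P => P.fn

/-- The name that replaces the binder `x` of `P` when `σ` is pushed under this binder. -/
def newBinder (σ : Name → Name) (x : Name) (P : Proc) : Name :=
  fresh ((P.fn \ {x}).image σ)

/-- Capture-avoiding simultaneous substitution; every binder is renamed to a name that does not
clash with the substituted names. -/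
def subst : Proc → (Name → Name) → Proc
  | sum n α P, σ =>
      sum n
        (fun i => match α i with
          | .inp y x => .inp (σ y) (newBinder σ x (P i))
          | .out y z => .out (σ y) (σ z)
          | .tau => .tau)
        (fun i => (P i).subst
          (match α i with
            | .inp _ x => Function.update σ x (newBinder σ x (P i))
            | .out _ _ => σ
            | .tau => σ))
  | res x P, σ => res (newBinder σ x P) (P.subst (Function.update σ x (newBinder σ x P)))
  | par P Q, σ => par (P.subst σ) (Q.subst σ)
  | repl P, σ => repl (P.subst σ)

/-- The substitution `P{z/x}`. -/
def subst1 (P : Proc) (x z : Name) : Proc := P.subst (Function.update id x z)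

/-- `(ν x₁) ⋯ (ν xₘ) P`. -/
def resAll (xs : List Name) (P : Proc) : Proc := xs.foldr res P

/-- `P₁ | ⋯ | Pₙ`. -/
def parAll (Ps : List Proc) : Proc := Ps.foldr par inact

end Proc

open Proc

/-- The axioms of structural congruence. A sum ranges over an unordered index set, hence
`reorder`. -/
inductive StructAxiom : Proc → Proc → Prop
  | reorder (n : ℕ) (α : Fin n → Prefix) (P : Fin n → Proc) (e : Equiv.Perm (Fin n)) :
      StructAxiom (sum n α P) (sum n (α ∘ e) (P ∘ e))
  | alphaInp (n : ℕ) (α : Fin n → Prefix) (P : Fin n → Proc) (i : Fin n) (y x x' : Name)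
      (hi : α i = .inp y x) (hx' : x' ∉ (P i).fn \ {x}) :
      StructAxiom (sum n α P)
        (sum n (Function.update α i (.inp y x')) (Function.update P i ((P i).subst1 x x')))
  | alphaRes (x x' : Name) (P : Proc) (hx' : x' ∉ P.fn \ {x}) :
      StructAxiom (res x P) (res x' (P.subst1 x x'))
  | resInact (x : Name) : StructAxiom (res x inact) inact
  | resRes (x y : Name) (P : Proc) : StructAxiom (res x (res y P)) (res y (res x P))
  | extrude (x : Name) (P Q : Proc) (hx : x ∉ P.fn) :
      StructAxiom (par P (res x Q)) (res x (par P Q))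
  | parInact (P : Proc) : StructAxiom (par P inact) P
  | parComm (P Q : Proc) : StructAxiom (par P Q) (par Q P)
  | parAssoc (P Q R : Proc) : StructAxiom (par P (par Q R)) (par (par P Q) R)
  | unfold (P : Proc) : StructAxiom (repl P) (par P (repl P))

/-- Structural congruence: the least congruence that contains the axioms. -/
inductive StructCong : Proc → Proc → Prop
  | ax {P Q : Proc} : StructAxiom P Q → StructCong P Q
  | refl (P : Proc) : StructCong P P
  | symm {P Q : Proc} : StructCong P Q → StructCong Q P
  | trans {P Q R : Proc} : StructCong P Q → StructCong Q R → StructCong P R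
  | sum (n : ℕ) (α : Fin n → Prefix) {P Q : Fin n → Proc} :
      (∀ i, StructCong (P i) (Q i)) → StructCong (.sum n α P) (.sum n α Q)
  | res (x : Name) {P Q : Proc} : StructCong P Q → StructCong (.res x P) (.res x Q)
  | par {P P' Q Q' : Proc} :
      StructCong P P' → StructCong Q Q' → StructCong (.par P Q) (.par P' Q')
  | repl {P Q : Proc} : StructCong P Q → StructCong (.repl P) (.repl Q)

/-- Reduction steps. -/
inductive Step : Proc → Proc → Prop
  | comm (n : ℕ) (α : Fin n → Prefix) (P : Fin n → Proc) (i : Fin n)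
      (m : ℕ) (β : Fin m → Prefix) (Q : Fin m → Proc) (j : Fin m) (y z x : Name)
      (hi : α i = .out y z) (hj : β j = .inp y x) :
      Step (.par (.sum n α P) (.sum m β Q)) (.par (P i) ((Q j).subst1 x z))
  | tau (n : ℕ) (α : Fin n → Prefix) (P : Fin n → Proc) (i : Fin n) (hi : α i = .tau) :
      Step (.sum n α P) (P i)
  | par {P P' : Proc} (Q : Proc) : Step P P' → Step (.par P Q) (.par P' Q)
  | res (x : Name) {P P' : Proc} : Step P P' → Step (.res x P) (.res x P')
  | struct {P Q Q' P' : Proc} :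
      StructCong P Q → Step Q Q' → StructCong Q' P' → Step P P'

/-- The two kinds of barbs on a channel. -/
inductive Polarity where
  | inp
  | out

/-- `Barb P (.inp, y)`: `P` has an unguarded input on the free channel `y`;
`Barb P (.out, y)`: `P` has an unguarded output on the free channel `y`. -/
def Barb : Proc → Polarity × Name → Prop
  | .sum _ α _, (.inp, y) => ∃ i x, α i = .inp y x
  | .sum _ α _, (.out, y) => ∃ i z, α i = .out y z
  | .res x P, b => b.2 ≠ x ∧ Barb P b
  | .par P Q, b => Barb P b ∨ Barb Q b
  | .repl P, b => Barb P b

/-- `P` is distributable into the processes of the list `Ps`. -/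
def Distributable (P : Proc) (Ps : List Proc) : Prop :=
  ∃ xs : List Name, StructCong P (resAll xs (parAll Ps))

/-- The operators of the calculus with their arities. -/
inductive Op : ℕ → Type
  | sum (n : ℕ) (α : Fin n → Prefix) : Op n
  | res (x : Name) : Op 1
  | par : Op 2
  | repl : Op 1

/-- Application of an operator to its arguments. -/
def Op.app : {k : ℕ} → Op k → (Fin k → Proc) → Proc
  | _, .sum n α, P => .sum n α P
  | _, .res x, P => .res x (P 0)
  | _, .par, P => .par (P 0) (P 1)
  | _, .repl, P => .repl (P 0)

end PiCalc

/-! ## Mixed sessions -/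

namespace CMVmix

/-- Values: variables (names), unit and booleans. -/
inductive Val where
  | name (x : Name)
  | unit
  | tt
  | ff

/-- Names in a value. -/
def Val.fn : Val → Finset Name
  | .name x => {x}
  | _ => ∅

/-- Application of a substitution of values for names to a value. -/
def Val.subst : Val → (Name → Val) → Val
  | .name x, σ => σ x
  | .unit, _ => .unit
  | .tt, _ => .tt
  | .ff, _ => .ff

/-- Linear and unrestricted choices. -/
inductive Qual where
  | lin
  | un

/-- Heads of branches: `out l v` is `l!v` and `inp l x` is `l?x`, which binds `x` in the
continuation. -/
inductive Head where
  | out (l : Label) (v : Val)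
  | inp (l : Label) (x : Name)

/-- Processes. `choice q y n M P` is the choice `q y ∑ i, M i . P i`, all of whose branches are on
the endpoint `y`, and `res y z _ P` is `(ν y z) P`, the restriction of the two distinct endpoints
of a channel. The subject of a choice is a value, since the untyped calculus may substitute a
constant for a received variable; a choice on a constant is stuck. -/
inductive Proc where
  | choice (q : Qual) (y : Val) (n : ℕ) (M : Fin n → Head) (P : Fin n → Proc)
  | par (P Q : Proc)
  | res (y z : Name) (hyz : y ≠ z) (P : Proc)
  | cond (v : Val) (P Q : Proc)
  | inact

namespace Proc

/-- Free names. -/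
def fn : Proc → Finset Name
  | choice _ y _ M P => y.fn ∪ Finset.univ.biUnion fun i =>
      match M i with
      | .out _ v => v.fn ∪ (P i).fn
      | .inp _ x => (P i).fn \ {x}
  | par P Q => P.fn ∪ Q.fn
  | res y z _ P => P.fn \ {y, z}
  | cond v P Q => v.fn ∪ P.fn ∪ Q.fn
  | inact => ∅

/-- A name that can replace a binder of `P`, with bound names `xs`, when `σ` is pushed under this
binder. Every larger name can be used as well. -/
def newBinder (σ : Name → Val) (xs : Finset Name) (P : Proc) : Name :=
  fresh ((P.fn \ xs).biUnion fun x => (σ x).fn)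

/-- Capture-avoiding simultaneous substitution; every binder is renamed to a name that does not
clash with the substituted values. -/
def subst : Proc → (Name → Val) → Proc
  | choice q y n M P, σ =>
      choice q (y.subst σ) n
        (fun i => match M i with
          | .out l v => .out l (v.subst σ)
          | .inp l x => .inp l (newBinder σ {x} (P i)))
        (fun i => (P i).subst
          (match M i with
            | .out _ _ => σ
            | .inp _ x => Function.update σ x (.name (newBinder σ {x} (P i)))))
  | par P Q, σ => par (P.subst σ) (Q.subst σ)
  | res y z _ P, σ =>
      res (newBinder σ {y, z} P) (newBinder σ {y, z} P + 1) (Nat.ne_of_lt (Nat.lt_succ_self _))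
        (P.subst (Function.update (Function.update σ y (.name (newBinder σ {y, z} P)))
          z (.name (newBinder σ {y, z} P + 1))))
  | cond v P Q, σ => cond (v.subst σ) (P.subst σ) (Q.subst σ)
  | inact, _ => inact

/-- The substitution `P{v/x}`. -/
def subst1 (P : Proc) (x : Name) (v : Val) : Proc := P.subst (Function.update Val.name x v)

/-- Application of a substitution of names for names. -/
def rename (P : Proc) (σ : Name → Name) : Proc := P.subst fun x => .name (σ x)

/-- `P₁ | ⋯ | Pₙ`. -/
def parAll (Ps : List Proc) : Proc := Ps.foldr par inact

/-- `(ν y₁ z₁) ⋯ (ν yₘ zₘ) P`. -/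
def resAll (cs : List {c : Name × Name // c.1 ≠ c.2}) (P : Proc) : Proc :=
  cs.foldr (fun c Q => res c.1.1 c.1.2 c.2 Q) P

end Proc

open Proc

/-- One α-conversion or one reordering of the summands of a choice, at the top of a term. -/
inductive TermAxiom : Proc → Proc → Prop
  | reorder (q : Qual) (y : Val) (n : ℕ) (M : Fin n → Head) (P : Fin n → Proc)
      (e : Equiv.Perm (Fin n)) :
      TermAxiom (choice q y n M P) (choice q y n (M ∘ e) (P ∘ e))
  | alphaInp (q : Qual) (y : Val) (n : ℕ) (M : Fin n → Head) (P : Fin n → Proc) (i : Fin n)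
      (l : Label) (x x' : Name) (hi : M i = .inp l x) (hx' : x' ∉ (P i).fn \ {x}) :
      TermAxiom (choice q y n M P)
        (choice q y n (Function.update M i (.inp l x'))
          (Function.update P i ((P i).subst1 x (.name x'))))
  | alphaRes (y z y' z' : Name) (hyz : y ≠ z) (hyz' : y' ≠ z') (P : Proc)
      (hy' : y' ∉ P.fn \ {y, z}) (hz' : z' ∉ P.fn \ {y, z}) :
      TermAxiom (res y z hyz P)
        (res y' z' hyz'
          (P.subst (Function.update (Function.update Val.name y (.name y')) z (.name z'))))

/-- The axioms of structural congruence. -/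
inductive StructAxiom : Proc → Proc → Prop
  | term {P Q : Proc} : TermAxiom P Q → StructAxiom P Q
  | resInact (y z : Name) (hyz : y ≠ z) : StructAxiom (res y z hyz inact) inact
  | resRes (a b c d : Name) (hab : a ≠ b) (hcd : c ≠ d)
      (h : Disjoint ({a, b} : Finset Name) {c, d}) (P : Proc) :
      StructAxiom (res a b hab (res c d hcd P)) (res c d hcd (res a b hab P))
  | extrude (y z : Name) (hyz : y ≠ z) (P Q : Proc) (hy : y ∉ P.fn) (hz : z ∉ P.fn) :
      StructAxiom (par P (res y z hyz Q)) (res y z hyz (par P Q))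
  | resSwap (y z : Name) (hyz : y ≠ z) (P : Proc) :
      StructAxiom (res y z hyz P) (res z y hyz.symm P)
  | parInact (P : Proc) : StructAxiom (par P inact) P
  | parComm (P Q : Proc) : StructAxiom (par P Q) (par Q P)
  | parAssoc (P Q R : Proc) : StructAxiom (par P (par Q R)) (par (par P Q) R)

/-- The least congruence that contains a relation. -/
inductive Cong (A : Proc → Proc → Prop) : Proc → Proc → Prop
  | ax {P Q : Proc} : A P Q → Cong A P Q
  | refl (P : Proc) : Cong A P P
  | symm {P Q : Proc} : Cong A P Q → Cong A Q P
  | trans {P Q R : Proc} : Cong A P Q → Cong A Q R → Cong A P R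
  | choice (q : Qual) (y : Val) (n : ℕ) (M : Fin n → Head) {P Q : Fin n → Proc} :
      (∀ i, Cong A (P i) (Q i)) → Cong A (.choice q y n M P) (.choice q y n M Q)
  | par {P P' Q Q' : Proc} : Cong A P P' → Cong A Q Q' → Cong A (.par P Q) (.par P' Q')
  | res (y z : Name) (hyz : y ≠ z) {P Q : Proc} :
      Cong A P Q → Cong A (.res y z hyz P) (.res y z hyz Q)
  | cond (v : Val) {P P' Q Q' : Proc} :
      Cong A P P' → Cong A Q Q' → Cong A (.cond v P Q) (.cond v P' Q')

/-- Identity of terms: up to α-conversion and the order of summands. -/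
def TermEq : Proc → Proc → Prop := Cong TermAxiom

/-- Structural congruence. -/
def StructCong : Proc → Proc → Prop := Cong StructAxiom

/-- What is left of the choice `C` after its branch with continuation `P` was taken: an
unrestricted choice remains available. -/
def residual : Qual → Proc → Proc → Proc
  | .lin, _, P => P
  | .un, C, P => .par P C

/-- Reduction steps. -/
inductive Step : Proc → Proc → Prop
  | comm (y z : Name) (hyz : y ≠ z)
      (q₁ : Qual) (n₁ : ℕ) (M₁ : Fin n₁ → Head) (P₁ : Fin n₁ → Proc) (i : Fin n₁)
      (q₂ : Qual) (n₂ : ℕ) (M₂ : Fin n₂ → Head) (P₂ : Fin n₂ → Proc) (j : Fin n₂)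
      (l : Label) (v : Val) (x : Name) (R : Proc)
      (hi : M₁ i = .out l v) (hj : M₂ j = .inp l x) :
      Step
        (.res y z hyz (.par (.choice q₁ (.name y) n₁ M₁ P₁)
          (.par (.choice q₂ (.name z) n₂ M₂ P₂) R)))
        (.res y z hyz (.par (residual q₁ (.choice q₁ (.name y) n₁ M₁ P₁) (P₁ i))
          (.par (residual q₂ (.choice q₂ (.name z) n₂ M₂ P₂) ((P₂ j).subst1 x v)) R)))
  | condTrue (P Q : Proc) : Step (.cond .tt P Q) P
  | condFalse (P Q : Proc) : Step (.cond .ff P Q) Q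
  | par {P P' : Proc} (Q : Proc) : Step P P' → Step (.par P Q) (.par P' Q)
  | res (y z : Name) (hyz : y ≠ z) {P P' : Proc} :
      Step P P' → Step (.res y z hyz P) (.res y z hyz P')
  | struct {P Q Q' P' : Proc} :
      StructCong P Q → Step Q Q' → StructCong Q' P' → Step P P'

/-- `P` has an unguarded choice on the free endpoint `a`. -/
def Barb : Proc → Name → Prop
  | .choice _ y _ _ _, a => y = .name a
  | .par P Q, a => Barb P a ∨ Barb Q a
  | .res y z _ P, a => a ≠ y ∧ a ≠ z ∧ Barb P a
  | .cond _ _ _, _ => False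
  | .inact, _ => False

/-- `P` is distributable into the processes of the list `Ps`. -/
def Distributable (P : Proc) (Ps : List Proc) : Prop :=
  ∃ cs, StructCong P (resAll cs (parAll Ps))

/-- Contexts with holes numbered by `Fin k`; a hole may be used any number of times. -/
inductive Ctx (k : ℕ) where
  | hole (i : Fin k)
  | choice (q : Qual) (y : Val) (n : ℕ) (M : Fin n → Head) (C : Fin n → Ctx k)
  | par (C D : Ctx k)
  | res (y z : Name) (hyz : y ≠ z) (C : Ctx k)
  | cond (v : Val) (C D : Ctx k)
  | inact

/-- Filling the holes of a context; as usual, binders of the context capture names. -/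
def Ctx.fill {k : ℕ} (T : Fin k → Proc) : Ctx k → Proc
  | .hole i => T i
  | .choice q y n M C => .choice q y n M fun i => (C i).fill T
  | .par C D => .par (C.fill T) (D.fill T)
  | .res y z hyz C => .res y z hyz (C.fill T)
  | .cond v C D => .cond v (C.fill T) (D.fill T)
  | .inact => .inact

end CMVmix

/-! ## Good encodings -/

open Relation (ReflTransGen)

/-- The encoding `enc` from the π-calculus into mixed sessions is good up to the relation `R` on
target terms. The π-calculus distinguishes input and output barbs on a channel, mixed sessions do
not: `obs` is the set of polarities of those source barbs on `y` that count as the barb `y`. -/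
structure IsGoodEncoding (obs : Set PiCalc.Polarity) (enc : PiCalc.Proc → CMVmix.Proc)
    (R : CMVmix.Proc → CMVmix.Proc → Prop) : Prop where
  equivalence : Equivalence R
  bisimulation : IsBisimulation CMVmix.Step CMVmix.Barb R
  /-- The translation of an operator is a context around the translations of its arguments; the
  context may depend on the free names of the arguments. -/
  compositional : ∀ (k : ℕ) (op : PiCalc.Op k) (N : Finset Name), ∃ C : CMVmix.Ctx k,
    ∀ S : Fin k → PiCalc.Proc, (Finset.univ.biUnion fun i => (S i).fn) = N →
      CMVmix.TermEq (enc (op.app S)) (C.fill fun i => enc (S i))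
  nameInvariant : ∀ (S : PiCalc.Proc) (σ : Name → Name), {x | σ x ≠ x}.Finite →
    R (enc (S.subst σ)) ((enc S).rename σ)
  complete : ∀ S S', ReflTransGen PiCalc.Step S S' →
    ∃ T, ReflTransGen CMVmix.Step (enc S) T ∧ R T (enc S')
  sound : ∀ S T, ReflTransGen CMVmix.Step (enc S) T →
    ∃ S', ReflTransGen PiCalc.Step S S' ∧ ∃ T', ReflTransGen CMVmix.Step T T' ∧ R T' (enc S')
  divergenceReflecting : ∀ S, Diverges CMVmix.Step (enc S) → Diverges PiCalc.Step S
  barbSensitive : ∀ (S : PiCalc.Proc) (y : Name),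
    (∃ p ∈ obs, WeakBarb PiCalc.Step PiCalc.Barb S (p, y)) ↔
      WeakBarb CMVmix.Step CMVmix.Barb (enc S) y
  distributabilityPreserving : ∀ (S : PiCalc.Proc) (Ss : List PiCalc.Proc), Ss ≠ [] →
    PiCalc.Distributable S Ss →
      ∃ Ts : List CMVmix.Proc, CMVmix.Distributable (enc S) Ts ∧
        List.Forall₂ (fun T S' => R T (enc S')) Ts Ss

end MixedSessions

namespace MixedSessions

open Relation (ReflTransGen)

/-! ## Barbs of mixed sessions are persistent

A step of mixed sessions consumes choices on the two endpoints of a restricted channel only, so an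
unguarded choice on a free endpoint stays available in all derivatives. -/

namespace CMVmix

open Proc

/-! In $\mathrm{CMV}^{+}$ communication consumes choices only on two endpoints bound by a
restriction, and conditionals carry no barbs. An unguarded choice on a free endpoint therefore
survives every step (`Step.barb`, `Barb.of_steps`). A mixed choice of the π-calculus can lose its
barb: the process `offer p y` shows a barb on `y`, but its `tau` summand leads to a process that
never shows any barb. An encoding cannot reconcile the two. By barb sensitivity the translation of
`offer p 0` reaches a term with the barb `0`, which persists from then on. By soundness some
derivative of that term is related to the translation of a derivative `S` of the offer. The
invariant `Withdrawable` shows that `S` can still reach a dead process `S'`. By completeness and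
bisimulation the target follows to a term related to the translation of `S'`. That term still has
the barb `0`, so barb sensitivity makes the dead `S'` reach a barb. -/

theorem Barb.mem_fn {P : Proc} {a : Name} (h : Barb P a) : a ∈ P.fn := by
  induction P with
  | choice q y n M P _ =>
    obtain rfl : y = .name a := h
    simp [fn, Val.fn]
  | par P Q ihP ihQ =>
    rcases h with h | h
    · simp [fn, ihP h]
    · simp [fn, ihQ h]
  | res y z hyz P ih =>
    obtain ⟨hy, hz, h⟩ := h
    simp [fn, ih h, hy, hz]
  | cond v P Q _ _ => exact h.elim
  | inact => exact h.elim

/-- A substitution may turn a subject into a constant, so a barb `b` survives only when `σ b` is a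
name. The fresh binders chosen by `subst` capture none of the resulting barbs. -/
theorem barb_subst_iff {P : Proc} {σ : Name → Val} {a : Name} :
    Barb (P.subst σ) a ↔ ∃ b, Barb P b ∧ σ b = .name a := by
  induction P generalizing σ with
  | choice q y n M P _ => cases y <;> simp [subst, Barb, Val.subst]
  | par P Q ihP ihQ => simp only [subst, Barb, ihP, ihQ, or_and_right, exists_or]
  | res y z hyz P ih =>
    -- The new endpoints are `newBinder` and its successor; one strict bound on `a` keeps it apart
    -- from both.
    have key : ∀ b, Barb P b → b ≠ y → b ≠ z → σ b = .name a → a < newBinder σ {y, z} P := by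
      intro b hb hy hz hσ
      refine lt_fresh_of_mem (Finset.mem_biUnion.2 ⟨b, ?_, by simp [hσ, Val.fn]⟩)
      simp [hb.mem_fn, hy, hz]
    simp only [subst, Barb, ih]
    generalize newBinder σ {y, z} P = w at key
    constructor
    · rintro ⟨h₁, h₂, b, hb, hσ⟩
      have hz : b ≠ z := by
        rintro rfl
        simp only [Function.update_self, Val.name.injEq] at hσ
        exact h₂ hσ.symm
      rw [Function.update_of_ne hz] at hσ
      have hy : b ≠ y := by
        rintro rfl
        simp only [Function.update_self, Val.name.injEq] at hσ
        exact h₁ hσ.symm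
      rw [Function.update_of_ne hy] at hσ
      exact ⟨b, ⟨hy, hz, hb⟩, hσ⟩
    · rintro ⟨b, ⟨hy, hz, hb⟩, hσ⟩
      have hlt := key b hb hy hz hσ
      refine ⟨hlt.ne, (Nat.lt_succ_of_lt hlt).ne, b, hb, ?_⟩
      rw [Function.update_of_ne hz, Function.update_of_ne hy, hσ]
  | cond v P Q _ _ => simp [subst, Barb]
  | inact => simp [subst, Barb]

theorem TermAxiom.barb_iff {P Q : Proc} (h : TermAxiom P Q) (a : Name) :
    Barb P a ↔ Barb Q a := by
  cases h with
  | reorder => exact Iff.rfl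
  | alphaInp => exact Iff.rfl
  | alphaRes y z y' z' hyz hyz' P hy' hz' =>
    simp only [Barb, barb_subst_iff]
    constructor
    · rintro ⟨hy, hz, h⟩
      have ha : a ∈ P.fn \ {y, z} := by simp [h.mem_fn, hy, hz]
      refine ⟨fun e => hy' (e ▸ ha), fun e => hz' (e ▸ ha), a, h, ?_⟩
      rw [Function.update_of_ne hz, Function.update_of_ne hy]
    · rintro ⟨h₁, h₂, b, hb, hσ⟩
      have hz : b ≠ z := by
        rintro rfl
        simp only [Function.update_self, Val.name.injEq] at hσ
        exact h₂ hσ.symm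
      rw [Function.update_of_ne hz] at hσ
      have hy : b ≠ y := by
        rintro rfl
        simp only [Function.update_self, Val.name.injEq] at hσ
        exact h₁ hσ.symm
      rw [Function.update_of_ne hy, Val.name.injEq] at hσ
      subst hσ
      exact ⟨hy, hz, hb⟩

theorem StructAxiom.barb_iff {P Q : Proc} (h : StructAxiom P Q) (a : Name) :
    Barb P a ↔ Barb Q a := by
  cases h with
  | term h => exact h.barb_iff a
  | resInact => simp [Barb]
  | resRes => simp only [Barb]; tauto
  | extrude y z hyz P Q hy hz =>
    -- A barb is a free name, so the side condition of scope extrusion keeps the extruded endpoints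
    -- from hiding barbs of `P`.
    have h₁ : Barb P a → a ≠ y := fun h e => hy (e ▸ h.mem_fn)
    have h₂ : Barb P a → a ≠ z := fun h e => hz (e ▸ h.mem_fn)
    simp only [Barb]
    tauto
  | resSwap => simp only [Barb]; tauto
  | parInact => simp [Barb]
  | parComm => simp only [Barb]; tauto
  | parAssoc => simp only [Barb]; tauto

theorem StructCong.barb_iff {P Q : Proc} (h : StructCong P Q) (a : Name) :
    Barb P a ↔ Barb Q a := by
  induction h with
  | ax h => exact h.barb_iff a
  | refl => exact Iff.rfl
  | symm _ ih => exact ih.symm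
  | trans _ _ ih₁ ih₂ => exact ih₁.trans ih₂
  | choice => exact Iff.rfl
  | par _ _ ih₁ ih₂ => simp only [Barb, ih₁, ih₂]
  | res _ _ _ _ ih => simp only [Barb, ih]
  | cond => exact Iff.rfl

/-- Persistence: both choices consumed by a communication have subjects bound by the enclosing
restriction, so a barb of a redex can only come from the bystander `R`. -/
theorem Step.barb {P P' : Proc} (h : Step P P') {a : Name} (ha : Barb P a) : Barb P' a := by
  induction h with
  | comm y z hyz q₁ n₁ M₁ P₁ i q₂ n₂ M₂ P₂ j l v x R hi hj =>
    obtain ⟨hy, hz, h | h | h⟩ := ha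
    · exact absurd (Val.name.inj h).symm hy
    · exact absurd (Val.name.inj h).symm hz
    · exact ⟨hy, hz, .inr (.inr h)⟩
  | condTrue => exact ha.elim
  | condFalse => exact ha.elim
  | par Q _ ih => exact ha.imp ih id
  | res y z hyz _ ih => exact ⟨ha.1, ha.2.1, ih ha.2.2⟩
  | struct h₁ _ h₂ ih => exact (h₂.barb_iff a).1 (ih ((h₁.barb_iff a).1 ha))

theorem Barb.of_steps {P P' : Proc} {a : Name} (ha : Barb P a) (h : ReflTransGen Step P P') :
    Barb P' a := by
  induction h with
  | refl => exact ha
  | tail _ h ih => exact h.barb ih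

end CMVmix

/-! ## Barbs of the π-calculus can be withdrawn -/

namespace PiCalc

open Proc

/-- All unguarded choices are empty. -/
def Dead : Proc → Prop
  | .sum n _ _ => n = 0
  | .res _ P => Dead P
  | .par P Q => Dead P ∧ Dead Q
  | .repl P => Dead P

theorem dead_subst_iff {P : Proc} {σ : Name → Name} : Dead (P.subst σ) ↔ Dead P := by
  induction P generalizing σ with
  | sum => exact Iff.rfl
  | res x P ih => exact ih
  | par P Q ihP ihQ => exact and_congr ihP ihQ
  | repl P ih => exact ih

theorem StructAxiom.dead_iff {P Q : Proc} (h : StructAxiom P Q) : Dead P ↔ Dead Q := by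
  cases h with
  | alphaRes => simp only [Dead, subst1, dead_subst_iff]
  | _ => simp only [Dead, inact]; try tauto

theorem StructCong.dead_iff {P Q : Proc} (h : StructCong P Q) : Dead P ↔ Dead Q := by
  induction h with
  | ax h => exact h.dead_iff
  | refl => exact Iff.rfl
  | symm _ ih => exact ih.symm
  | trans _ _ ih₁ ih₂ => exact ih₁.trans ih₂
  | sum => exact Iff.rfl
  | res _ _ ih => exact ih
  | par _ _ ih₁ ih₂ => exact and_congr ih₁ ih₂
  | repl _ ih => exact ih

theorem Dead.not_step {P P' : Proc} (hP : Dead P) : ¬ Step P P' := by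
  intro h
  induction h with
  | comm n α P i m β Q j y z x hi hj =>
    obtain rfl : n = 0 := hP.1
    exact i.elim0
  | tau n α P i hi =>
    obtain rfl : n = 0 := hP
    exact i.elim0
  | par Q _ ih => exact ih hP.1
  | res x _ ih => exact ih hP
  | struct h₁ _ _ ih => exact ih (h₁.dead_iff.1 hP)

theorem Dead.not_barb {P : Proc} (hP : Dead P) (b : Polarity × Name) : ¬ Barb P b := by
  induction P with
  | sum n α P _ =>
    obtain rfl : n = 0 := hP
    rcases b with ⟨_ | _, y⟩ <;> exact fun ⟨i, _⟩ => i.elim0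
  | res x P ih => exact fun h => ih hP h.2
  | par P Q ihP ihQ => exact fun h => h.elim (ihP hP.1) (ihQ hP.2)
  | repl P ih => exact ih hP

theorem Dead.not_weakBarb {P : Proc} (hP : Dead P) (b : Polarity × Name) :
    ¬ WeakBarb Step Barb P b := by
  rintro ⟨P', h, hb⟩
  rcases h.cases_head with rfl | ⟨Q, hQ, _⟩
  · exact hP.not_barb b hb
  · exact hP.not_step hQ

/-- Every non-empty unguarded choice has dead continuations and can be withdrawn by an internal
step. -/
def Withdrawable : Proc → Prop
  | .sum n α P => n = 0 ∨ (∃ i, α i = .tau) ∧ ∀ i, Dead (P i)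
  | .res _ P => Withdrawable P
  | .par P Q => Withdrawable P ∧ Withdrawable Q
  | .repl P => Dead P

theorem Dead.withdrawable {P : Proc} (hP : Dead P) : Withdrawable P := by
  induction P with
  | sum => exact .inl hP
  | res x P ih => exact ih hP
  | par P Q ihP ihQ => exact ⟨ihP hP.1, ihQ hP.2⟩
  | repl P _ => exact hP

theorem withdrawable_subst_iff {P : Proc} {σ : Name → Name} :
    Withdrawable (P.subst σ) ↔ Withdrawable P := by
  induction P generalizing σ with
  | sum n α P _ =>
    simp only [subst, Withdrawable, dead_subst_iff]
    refine or_congr_right (and_congr_left fun _ => exists_congr fun i => ?_)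
    cases α i <;> simp
  | res x P ih => exact ih
  | par P Q ihP ihQ => exact and_congr ihP ihQ
  | repl P _ => exact dead_subst_iff

theorem StructAxiom.withdrawable_iff {P Q : Proc} (h : StructAxiom P Q) :
    Withdrawable P ↔ Withdrawable Q := by
  cases h with
  | reorder n α P e =>
    exact or_congr_right (and_congr (e.surjective.exists (p := fun i => α i = .tau))
      (e.surjective.forall (p := fun i => Dead (P i))))
  | alphaInp n α P i y x x' hi hx' =>
    simp only [Withdrawable]
    refine or_congr_right (and_congr (exists_congr fun j => ?_) (forall_congr' fun j => ?_))
    all_goals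
      rcases eq_or_ne j i with rfl | hj
      · simp [hi, subst1, dead_subst_iff]
      · simp [hj]
  | alphaRes => simp only [Withdrawable, subst1, withdrawable_subst_iff]
  -- Replication demands `Dead P` rather than `Withdrawable P`: unfolding supplies ever new copies
  -- of `P`, and live ones could never all be withdrawn.
  | unfold P => exact ⟨fun h => ⟨Dead.withdrawable h, h⟩, fun h => h.2⟩
  | _ => simp only [Withdrawable, inact]; try tauto

theorem StructCong.withdrawable_iff {P Q : Proc} (h : StructCong P Q) :
    Withdrawable P ↔ Withdrawable Q := by
  induction h with
  | ax h => exact h.withdrawable_iff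
  | refl => exact Iff.rfl
  | symm _ ih => exact ih.symm
  | trans _ _ ih₁ ih₂ => exact ih₁.trans ih₂
  | sum n α h _ => simp only [Withdrawable, fun i => (h i).dead_iff]
  | res _ _ ih => exact ih
  | par _ _ ih₁ ih₂ => exact and_congr ih₁ ih₂
  | repl h _ => exact h.dead_iff

/-- Whichever summand fires, its continuation is dead, and deadness is insensitive to the received
name. -/
theorem Step.withdrawable {P P' : Proc} (h : Step P P') (hP : Withdrawable P) :
    Withdrawable P' := by
  induction h with
  | comm n α P i m β Q j y z x hi hj =>
    obtain ⟨rfl | ⟨-, hP⟩, rfl | ⟨-, hQ⟩⟩ := hP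
    · exact i.elim0
    · exact i.elim0
    · exact j.elim0
    · exact ⟨(hP i).withdrawable, withdrawable_subst_iff.2 (hQ j).withdrawable⟩
  | tau n α P i hi =>
    obtain rfl | ⟨-, hP⟩ := hP
    · exact i.elim0
    · exact (hP i).withdrawable
  | par Q _ ih => exact ⟨ih hP.1, hP.2⟩
  | res x _ ih => exact ih hP
  | struct h₁ _ h₂ ih => exact h₂.withdrawable_iff.1 (ih (h₁.withdrawable_iff.1 hP))

theorem Withdrawable.of_steps {P P' : Proc} (hP : Withdrawable P)
    (h : ReflTransGen Step P P') : Withdrawable P' := by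
  induction h with
  | refl => exact hP
  | tail _ h ih => exact h.withdrawable ih

theorem Step.par_right (P : Proc) {Q Q' : Proc} (h : Step Q Q') :
    Step (.par P Q) (.par P Q') :=
  .struct (.ax (.parComm P Q)) (.par P h) (.ax (.parComm Q' P))

/-- Each non-empty unguarded choice takes its own `tau` summand, and parallel components do so
independently. -/
theorem Withdrawable.exists_dead {P : Proc} (hP : Withdrawable P) :
    ∃ P', ReflTransGen Step P P' ∧ Dead P' := by
  induction P with
  | sum n α P _ =>
    obtain rfl | ⟨⟨i, hi⟩, hP⟩ := hP
    · exact ⟨_, .refl, rfl⟩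
    · exact ⟨P i, .single (.tau n α P i hi), hP i⟩
  | res x P ih =>
    obtain ⟨P', h, hd⟩ := ih hP
    exact ⟨.res x P', ReflTransGen.lift (Proc.res x) (fun _ _ => Step.res x) _ _ h, hd⟩
  | par P Q ihP ihQ =>
    obtain ⟨P', hP', hdP⟩ := ihP hP.1
    obtain ⟨Q', hQ', hdQ⟩ := ihQ hP.2
    exact ⟨.par P' Q', (ReflTransGen.lift (Proc.par · Q) (fun _ _ => Step.par Q) _ _ hP').trans
      (ReflTransGen.lift (Proc.par P') (fun _ _ => Step.par_right P') _ _ hQ'), hdP, hdQ⟩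
  | repl P _ => exact ⟨_, .refl, hP⟩

/-- A prefix of polarity `p` on the channel `y`. -/
def Polarity.action (p : Polarity) (y : Name) : Prefix :=
  match p with
  | .inp => .inp y y
  | .out => .out y y

/-- The choice between a prefix of polarity `p` on `y` and an internal step. -/
def offer (p : Polarity) (y : Name) : Proc :=
  .sum 2 ![p.action y, .tau] fun _ => inact

theorem withdrawable_offer (p : Polarity) (y : Name) : Withdrawable (offer p y) :=
  .inr ⟨⟨1, rfl⟩, fun _ => rfl⟩

theorem barb_offer (p : Polarity) (y : Name) : Barb (offer p y) (p, y) := by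
  -- The witness `y` is the object of the prefix, which reuses the channel name; its value plays no
  -- role for the barb.
  cases p <;> exact ⟨0, y, rfl⟩

end PiCalc

end MixedSessions

open MixedSessions in
theorem mainTheorem1 (obs : Set PiCalc.Polarity) (hobs : obs.Nonempty) :
    ¬ ∃ (enc : PiCalc.Proc → CMVmix.Proc) (R : CMVmix.Proc → CMVmix.Proc → Prop),
      IsGoodEncoding obs enc R := by
  rintro ⟨enc, R, h⟩
  obtain ⟨p, hp⟩ := hobs
  -- The translation of an offer on `0` reaches the barb `0` and keeps it from then on.
  obtain ⟨T, hT, hbT⟩ := (h.barbSensitive (PiCalc.offer p 0) 0).1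
    ⟨p, hp, _, .refl, PiCalc.barb_offer p 0⟩
  -- Soundness may require `T` to run on to `T'`; persistence makes this harmless.
  obtain ⟨S, hS, T', hT', hR⟩ := h.sound _ _ hT
  -- The corresponding source process can still withdraw the offer.
  obtain ⟨S', hS', hdead⟩ := ((PiCalc.withdrawable_offer p 0).of_steps hS).exists_dead
  obtain ⟨U, hU, hRU⟩ := h.complete _ _ hS'
  -- The withdrawal is replayed from `T'`, a term that already has the barb, so `T''` keeps the barb
  -- although it is related to the translation of the dead `S'`.
  obtain ⟨T'', hT'', hRT⟩ := h.bisimulation.back _ _ hR _ hU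
  have hb := (h.bisimulation.barbs _ _ (h.equivalence.trans hRT hRU) 0).1
    ⟨T'', .refl, (hbT.of_steps hT').of_steps hT''⟩
  obtain ⟨q, -, hq⟩ := (h.barbSensitive S' 0).2 hb
  exact hdead.not_weakBarb _ hq
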